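/- Let $N\ge 1$, let $g=\sum_{n\ge1}a_g(n)q^n\in S_2(\Gamma_0(N))$ be a normalized newform with integral Fourier coefficients $a_g(n)\in\mathbb Z$ and with complex multiplication by an imaginary quadratic field $K$ (that is, $g=\sum_{\mathfrak a}\psi(\mathfrak a)q^{N(\mathfrak a)}$ for a Hecke character $\psi$ of $K$, modulo some nonzero ideal $\mathfrak m$, with $\psi((\alpha))=\sigma(\alpha)$ for $\alpha\equiv1\bmod\mathfrak m$ and an embedding $\sigma:K\to\mathbb C$). Let $p$ be a prime number which is inert in $K$ and does not divide $N$, and let $$E_g(q)=\sum_{n\ge1}\frac{a_g(n)}{n}\,q^n\in\mathbb Q_p[\![q]\!]$$ be the Eichler integral of $g$. Let $\mathcal P=\{\sum_{n\ge1}c_ns^n\in\mathbb Q_p[\![s]\!] : nc_n\in\mathbb Z_p\text{ for all }n\}$, and put $\varphi(f)(s)=f((1+s)^p-1)$ and $F(f)(s)=f(s^p)$. For $u(X)=\sum_i b_iX^i\in\mathbb Z_p[X]$, a series $f\in\mathcal P$ is said to be of the Honda type $u$ if $f'(0)=1$ and both $u(\varphi)(f)=\sum_i b_i\varphi^i(f)$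 and $u(F)(f)=\sum_i b_iF^i(f)$ lie in $p\mathbb Z_p[\![s]\!]$. Then $E_g$ is of the Honda type $X^2+p$. In particular $$(\varphi^2+p)E_g\in p\,\mathbb Z_p[\![q]\!]\qquad\text{and}\qquad (F^2+p)E_g\in p\,\mathbb Z_p[\![q]\!].$$ -/

import Mathlib

open scoped MatrixGroups NumberField ModularForm

noncomputable section

namespace CMHonda

open UpperHalfPlane CongruenceSubgroup

/-! ### Newforms on `Γ₀(N)` -/

/-- The space `S_k(Γ₀(N))` of cusp forms of weight `k` and level `Γ₀(N)`. -/
abbrev S (N : ℕ) (k : ℤ) : Type :=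
  CuspForm (Gamma0 N : Subgroup (GL (Fin 2) ℝ)) k

/-- The `n`-th Fourier coefficient at `∞` of `f`, with respect to `q = exp (2 π i τ)`. -/
def fourierCoeff {N : ℕ} {k : ℤ} (f : S N k) (n : ℕ) : ℂ :=
  (qExpansion 1 (f : ℍ → ℂ)).coeff n

/-- The function `τ ↦ f (d τ)` on the upper half plane (used for `d ≥ 1`). -/
def scale (d : ℕ) (f : ℍ → ℂ) : ℍ → ℂ :=
  fun τ => f (ofComplex ((d : ℂ) * (τ : ℂ)))

/-- The Hecke operator at the prime `ℓ` in weight `k` and level `Γ₀(N)`: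
`(T_ℓ f)(τ) = ℓ ^ (k - 1) f (ℓ τ) + ℓ⁻¹ ∑_{j < ℓ} f ((τ + j) / ℓ)`,
where the first term is absent if `ℓ ∣ N`. -/
def heckeOp (N : ℕ) (k : ℤ) (ℓ : ℕ) (f : ℍ → ℂ) : ℍ → ℂ := fun τ =>
  (if ℓ ∣ N then 0 else (ℓ : ℂ) ^ (k - 1) * scale ℓ f τ) +
    (ℓ : ℂ)⁻¹ * ∑ j ∈ Finset.range ℓ, f (ofComplex (((τ : ℂ) + (j : ℂ)) / (ℓ : ℂ)))

/-- The (unnormalised) Petersson product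
`∫_{Γ₀(N)\ℍ} conj (f τ) * h τ * (im τ) ^ k dx dy / y ^ 2`, computed on the fundamental domain
of `Γ₀(N)` which is the union of the translates of the standard fundamental domain of `SL(2, ℤ)` by
representatives of the cosets `Γ₀(N) γ`.  If `c` runs through the left cosets `γ Γ₀(N)`, then the
inverses of representatives run through representatives of the cosets `Γ₀(N) γ`. -/
def peterssonProduct (N : ℕ) (k : ℤ) (f h : ℍ → ℂ) : ℂ :=
  ∑ᶠ c : SL(2, ℤ) ⧸ Gamma0 N,
    ∫ τ in ModularGroup.fd, petersson k f h ((Quotient.out c)⁻¹ • τ)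

/-- `g` belongs to the new subspace: it is orthogonal to all oldforms `f (d τ)` with
`f ∈ S_k(Γ₀(M))`, `d M ∣ N` and `M ≠ N`. -/
def IsNew {N : ℕ} {k : ℤ} (g : S N k) : Prop :=
  ∀ M d : ℕ, d * M ∣ N → M ≠ N → ∀ f : S M k,
    peterssonProduct N k (scale d (f : ℍ → ℂ)) (g : ℍ → ℂ) = 0

/-- `g` is a normalized newform of level `Γ₀(N)`: it lies in the new subspace, its first Fourier
coefficient is `1`, and it is an eigenform of all Hecke operators. -/
structure IsNormalizedNewform {N : ℕ} {k : ℤ} (g : S N k) : Prop where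
  isNew : IsNew g
  normalized : fourierCoeff g 1 = 1
  eigenform : ∀ ℓ : ℕ, ℓ.Prime → ∃ c : ℂ, ∀ τ : ℍ, heckeOp N k ℓ (g : ℍ → ℂ) τ = c * g τ

/-! ### Complex multiplication -/

/-- `K` is an imaginary quadratic field. -/
structure IsImaginaryQuadratic (K : Type*) [Field K] [NumberField K] : Prop where
  finrank_eq : Module.finrank ℚ K = 2
  isTotallyComplex : NumberField.IsTotallyComplex K

/-- `ψ` is a Hecke character (Größencharakter) of the field `K` modulo the nonzero ideal `𝔪`, with
infinity type `σ ^ (k - 1)`, viewed as a multiplicative function on all integral ideals which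
vanishes exactly on the ideals that are not coprime to `𝔪` (and on the zero ideal). -/
structure IsHeckeCharacter {K : Type*} [Field K] [NumberField K] (k : ℤ) (𝔪 : Ideal (𝓞 K))
    (σ : K →+* ℂ) (ψ : Ideal (𝓞 K) →*₀ ℂ) : Prop where
  modulus_ne_bot : 𝔪 ≠ ⊥
  ne_zero_iff : ∀ I : Ideal (𝓞 K), I ≠ ⊥ → (ψ I ≠ 0 ↔ I ⊔ 𝔪 = ⊤)
  principal : ∀ α : 𝓞 K, α ≠ 0 → α - 1 ∈ 𝔪 →
    ψ (Ideal.span {α}) = σ (α : K) ^ (k - 1)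

/-- `g` has complex multiplication by `K`: it is the theta series
`∑_𝔞 ψ(𝔞) q ^ N(𝔞)` of a Hecke character `ψ` of `K` with infinity type `σ ^ (k - 1)`. -/
def HasCM {N : ℕ} {k : ℤ} (g : S N k) (K : Type*) [Field K] [NumberField K] : Prop :=
  ∃ (𝔪 : Ideal (𝓞 K)) (σ : K →+* ℂ) (ψ : Ideal (𝓞 K) →*₀ ℂ), IsHeckeCharacter k 𝔪 σ ψ ∧
    ∀ n : ℕ, 1 ≤ n →
      fourierCoeff g n = ∑ᶠ (I : Ideal (𝓞 K)) (_ : Ideal.absNorm I = n), ψ I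

/-- The rational prime `p` is inert in `K`, i.e. `p 𝓞_K` is a prime ideal. -/
def IsInert (p : ℕ) (K : Type*) [Field K] [NumberField K] : Prop :=
  (Ideal.span {(p : 𝓞 K)}).IsPrime

/-! ### Honda types -/

variable (p : ℕ) [Fact p.Prime]

/-- The power series `∑_{n ≥ 1} a_n s ^ n` over `ℚ_p` with `n a_n ∈ ℤ_p` for all `n`. -/
def P : Set (PowerSeries ℚ_[p]) :=
  {f | f.coeff 0 = 0 ∧ ∀ n : ℕ, ∃ z : ℤ_[p], (n : ℚ_[p]) * f.coeff n = (z : ℚ_[p])}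

/-- The power series with all coefficients in `p ℤ_p`, i.e. `p ℤ_p⟦s⟧`. -/
def pIntegral : Set (PowerSeries ℚ_[p]) :=
  {f | ∀ n : ℕ, ∃ z : ℤ_[p], f.coeff n = (p : ℚ_[p]) * (z : ℚ_[p])}

/-- `φ (f) (s) = f ((1 + s) ^ p - 1)`. -/
def phi (f : PowerSeries ℚ_[p]) : PowerSeries ℚ_[p] :=
  PowerSeries.subst (((1 + PowerSeries.X) ^ p - 1 : PowerSeries ℚ_[p])) f

/-- The Frobenius `F (f) (s) = f (s ^ p)`. -/
def frob (f : PowerSeries ℚ_[p]) : PowerSeries ℚ_[p] :=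
  PowerSeries.subst ((PowerSeries.X ^ p : PowerSeries ℚ_[p])) f

variable {p}

/-- `u (Φ) (f) = ∑ i, b_i Φ^i (f)` for `u = ∑ i, b_i X ^ i`. -/
def evalOp (u : Polynomial ℤ_[p]) (Φ : PowerSeries ℚ_[p] → PowerSeries ℚ_[p])
    (f : PowerSeries ℚ_[p]) : PowerSeries ℚ_[p] :=
  u.sum fun i b => (b : ℚ_[p]) • Φ^[i] f

/-- `f` is of the Honda type `u`. -/
structure IsOfHondaType (u : Polynomial ℤ_[p]) (f : PowerSeries ℚ_[p]) : Prop where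
  mem_P : f ∈ P p
  coeff_one : f.coeff 1 = 1
  phi_mem : evalOp u (phi p) f ∈ pIntegral p
  frob_mem : evalOp u (frob p) f ∈ pIntegral p

variable (p)

/-- The Eichler integral `∑_{n ≥ 1} (a n / n) q ^ n` in `ℚ_p⟦q⟧` of the weight `2` form with integral
Fourier coefficients `a n`. -/
def eichlerIntegral (a : ℕ → ℤ) : PowerSeries ℚ_[p] :=
  PowerSeries.mk fun n => if n = 0 then 0 else (a n : ℚ_[p]) / (n : ℚ_[p])

end CMHonda

end

namespace CMHonda

open UpperHalfPlane CongruenceSubgroup Function.Periodic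

/-! Since `p` is inert in the quadratic field `K`, the only candidate for an ideal of norm `p` is
`(p)`, whose norm is `p ^ 2`. Hence `a p = 0`, the eigenvalue of `T_p` vanishes, and the Hecke
relation becomes `a (p n) = -p a (n / p)`, with `a (n / p) = 0` when `p ∤ n`.

This makes the coefficients of `(F² + p) E` vanish at multiples of `p`; elsewhere they are `p a n /
n` with `n` a `p`-adic unit (`frob_frob_eichlerIntegral_mem`).

The statement for `φ` follows by comparison. Modulo `p`, `(1 + s) ^ p² - 1` and `s ^ p²` agree, so
their `n`-th powers agree modulo `p n`. The extra factor `n` absorbs the denominators of a series in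
`P`, so `φ² E ≡ F² E` modulo `p` (`phi_phi_sub_frob_frob_mem`). -/

lemma qParam_one_natCast_mul (d : ℕ) (z : ℂ) : qParam 1 (d * z) = qParam 1 z ^ d := by
  rw [qParam, qParam, ← Complex.exp_nat_mul]
  congr 1
  ring

lemma qParam_one_add (z w : ℂ) : qParam 1 (z + w) = qParam 1 z * qParam 1 w := by
  rw [qParam, qParam, qParam, ← Complex.exp_add]
  congr 1
  ring

lemma hasSum_fourierCoeff {N : ℕ} {k : ℤ} (g : S N k) {z : ℂ} (hz : 0 < z.im) :
    HasSum (fun n => fourierCoeff g n * qParam 1 z ^ n) (g (ofComplex z)) := by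
  have h1 : (1 : ℝ) ∈ (Gamma0 N : Subgroup (GL (Fin 2) ℝ)).strictPeriods := by simp
  have : Fact (IsCusp OnePoint.infty (Gamma0 N : Subgroup (GL (Fin 2) ℝ))) :=
    ⟨Subgroup.isCusp_of_mem_strictPeriods one_pos h1⟩
  have := ModularForm.hasSum_qExpansion (f := g) one_pos h1 (ofComplex z)
  rw [ofComplex_apply_of_im_pos hz] at this ⊢
  exact this

/-- A series supported on the multiples of `d`. -/
lemma hasSum_ite_dvd_iff {d : ℕ} (hd : 0 < d) {f : ℕ → ℂ} {s : ℂ} :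
    HasSum (fun n => if d ∣ n then f n else 0) s ↔ HasSum (fun m => f (d * m)) s := by
  have hinj : Function.Injective fun m : ℕ => d * m := fun m n h => Nat.eq_of_mul_eq_mul_left hd h
  rw [← hinj.hasSum_iff]
  · simp [Function.comp_def]
  · intro n hn
    rw [if_neg]
    rintro ⟨m, rfl⟩
    exact hn ⟨m, rfl⟩

lemma hasSum_scale {N : ℕ} {k : ℤ} (g : S N k) {d : ℕ} (hd : 0 < d) (τ : ℍ) :
    HasSum (fun n => (if d ∣ n then fourierCoeff g (n / d) else 0) * qParam 1 τ ^ n)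
      (scale d g τ) := by
  have him : 0 < ((d : ℂ) * (τ : ℂ)).im := by
    simpa using mul_pos (Nat.cast_pos.2 hd) τ.im_pos
  simp only [ite_mul, zero_mul]
  rw [hasSum_ite_dvd_iff hd]
  simpa [Nat.mul_div_cancel_left _ hd, pow_mul, qParam_one_natCast_mul, scale] using
    hasSum_fourierCoeff g him

/-- Orthogonality of the additive characters of `ℤ / dℤ`. -/
lemma sum_qParam_div_pow {d : ℕ} (hd : 0 < d) (n : ℕ) :
    ∑ j ∈ Finset.range d, qParam 1 ((j : ℂ) / d) ^ n = if d ∣ n then (d : ℂ) else 0 := by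
  have hd' : (d : ℂ) ≠ 0 := Nat.cast_ne_zero.2 hd.ne'
  have hζ : IsPrimitiveRoot (qParam 1 (1 / d)) d := by
    convert! Complex.isPrimitiveRoot_exp d hd.ne' using 1
    rw [qParam]
    congr 1
    simp only [Complex.ofReal_one]
    ring
  have hj (j : ℕ) : qParam 1 ((j : ℂ) / d) ^ n = (qParam 1 (1 / d) ^ n) ^ j := by
    rw [← pow_mul, mul_comm, pow_mul, ← qParam_one_natCast_mul j, mul_one_div]
  simp only [hj]
  split_ifs with h
  · simp only [(hζ.pow_eq_one_iff_dvd n).2 h]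
    simp
  · have h1 : qParam 1 (1 / d) ^ n ≠ 1 := fun h' => h ((hζ.pow_eq_one_iff_dvd n).1 h')
    rw [geom_sum_eq h1, ← pow_mul, mul_comm n d, pow_mul, hζ.pow_eq_one, one_pow, sub_self,
      zero_div]

/-- Averaging over the translates by `j` kills every exponent not divisible by `d`, by orthogonality
of characters. -/
lemma hasSum_average {N : ℕ} {k : ℤ} (g : S N k) {d : ℕ} (hd : 0 < d) (τ : ℍ) :
    HasSum (fun n => fourierCoeff g (d * n) * qParam 1 τ ^ n)
      ((d : ℂ)⁻¹ * ∑ j ∈ Finset.range d, g (ofComplex (((τ : ℂ) + (j : ℂ)) / (d : ℂ)))) := by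
  have hd' : (d : ℂ) ≠ 0 := Nat.cast_ne_zero.2 hd.ne'
  have him (j : ℕ) : 0 < (((τ : ℂ) + (j : ℂ)) / (d : ℂ)).im := by
    rw [Complex.div_natCast_im]
    simpa using div_pos τ.im_pos (Nat.cast_pos.2 hd)
  have h := (hasSum_sum fun j (_ : j ∈ Finset.range d) =>
    hasSum_fourierCoeff g (him j)).mul_left (d : ℂ)⁻¹
  have hterm (n : ℕ) : (d : ℂ)⁻¹ * ∑ j ∈ Finset.range d,
      fourierCoeff g n * qParam 1 (((τ : ℂ) + (j : ℂ)) / (d : ℂ)) ^ n =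
      if d ∣ n then fourierCoeff g n * qParam 1 ((τ : ℂ) / d) ^ n else 0 := by
    simp only [add_div, qParam_one_add, mul_pow, ← mul_assoc]
    rw [← Finset.mul_sum, sum_qParam_div_pow hd]
    split_ifs
    · field_simp
    · simp
  simp only [hterm] at h
  rw [hasSum_ite_dvd_iff hd] at h
  refine h.congr_fun fun n => ?_
  rw [pow_mul, ← qParam_one_natCast_mul d, mul_div_cancel₀ _ hd']

/-- The action of `T_ℓ`, `ℓ ∤ N`, on Fourier coefficients. -/
lemma fourierCoeff_hecke {N : ℕ} {k : ℤ} (g : S N k) {ℓ : ℕ} (hℓ : ℓ.Prime) (hN : ¬ ℓ ∣ N) {c : ℂ}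
    (hc : ∀ τ : ℍ, heckeOp N k ℓ g τ = c * g τ) (n : ℕ) :
    (ℓ : ℂ) ^ (k - 1) * (if ℓ ∣ n then fourierCoeff g (n / ℓ) else 0) + fourierCoeff g (ℓ * n) =
      c * fourierCoeff g n := by
  have h1 : (1 : ℝ) ∈ (Gamma0 N : Subgroup (GL (Fin 2) ℝ)).strictPeriods := by simp
  have hsum (τ : ℍ) : HasSum (fun n => ((ℓ : ℂ) ^ (k - 1) *
      (if ℓ ∣ n then fourierCoeff g (n / ℓ) else 0) + fourierCoeff g (ℓ * n)) • qParam 1 τ ^ n)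
      ((c • g) τ) := by
    have := ((hasSum_scale g hℓ.pos τ).mul_left ((ℓ : ℂ) ^ (k - 1))).add
      (hasSum_average g hℓ.pos τ)
    have h2 := hc τ
    rw [heckeOp, if_neg hN] at h2
    rw [h2] at this
    convert! this using 2 with n
    rw [smul_eq_mul]
    ring
  rw [ModularFormClass.qExpansion_coeff_unique one_pos h1 hsum n, fourierCoeff,
    FunLike.coe_smul, ModularForm.qExpansion_smul one_pos h1]
  simp

/-- No ideal has norm equal to an inert prime, so the Fourier coefficient vanishes there. -/
lemma fourierCoeff_inert_eq_zero {N : ℕ} {k : ℤ} {g : S N k} {K : Type*} [Field K] [NumberField K]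
    (hK : IsImaginaryQuadratic K) (hCM : HasCM g K) {p : ℕ} (hp : p.Prime) (hin : IsInert p K) :
    fourierCoeff g p = 0 := by
  obtain ⟨𝔪, σ, ψ, -, hψ⟩ := hCM
  rw [hψ p hp.one_le]
  refine finsum_eq_zero_of_forall_eq_zero fun I => ?_
  suffices hI : ¬ Ideal.absNorm I = p by simp [hI]
  intro hI
  have hp0 : (p : 𝓞 K) ≠ 0 := Nat.cast_ne_zero.2 hp.ne_zero
  have hle : Ideal.span {(p : 𝓞 K)} ≤ I := by
    rw [← hI]
    exact Ideal.span_singleton_absNorm_le I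
  have hmax : (Ideal.span {(p : 𝓞 K)}).IsMaximal :=
    Ideal.IsPrime.isMaximal hin (by simpa using hp0)
  have hne : I ≠ ⊤ := by
    rintro rfl
    rw [Ideal.absNorm_top] at hI
    exact hp.one_lt.ne hI
  have heq := hmax.eq_of_le hne hle
  -- Now `I = (p)`, so its norm is both `p` and `p ^ 2`.
  rw [← heq, Ideal.absNorm_span_singleton, ← map_natCast (algebraMap ℤ (𝓞 K)),
    Algebra.norm_algebraMap, NumberField.RingOfIntegers.rank, hK.finrank_eq] at hI
  simp only [Int.natAbs_pow, Int.natAbs_natCast] at hI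
  have := hp.one_lt
  nlinarith

/-! ### Congruences modulo `p` between substitutions -/

variable {p : ℕ} [Fact p.Prime]

lemma add_mem_pIntegral {f h : PowerSeries ℚ_[p]} (hf : f ∈ pIntegral p) (hh : h ∈ pIntegral p) :
    f + h ∈ pIntegral p := by
  intro n
  obtain ⟨x, hx⟩ := hf n
  obtain ⟨y, hy⟩ := hh n
  exact ⟨x + y, by rw [map_add, hx, hy, PadicInt.coe_add, mul_add]⟩

/-- If `A ≡ B` modulo `p`, then `A ^ n ≡ B ^ n` modulo `p n`. -/
lemma natCast_mul_dvd_pow_sub_pow {R : Type*} [CommRing R] [Algebra ℤ_[p] R] {x y : R}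
    (h : (p : R) ∣ x - y) (n : ℕ) : (p : R) * (n : R) ∣ x ^ n - y ^ n := by
  rcases eq_or_ne n 0 with rfl | hn
  · simp
  obtain ⟨k, m, hm, rfl⟩ := Nat.exists_eq_pow_mul_and_not_dvd hn p (Fact.out : p.Prime).ne_one
  have hu : IsUnit (m : R) := by
    have : IsUnit (m : ℤ_[p]) := by
      rw [PadicInt.isUnit_iff, PadicInt.norm_natCast_eq_one_iff]
      exact (Nat.Prime.coprime_iff_not_dvd Fact.out).2 hm
    simpa using this.map (algebraMap ℤ_[p] R)
  -- Each `p`-th power gains one factor `p`; the prime-to-`p` part `m` of `n` is a unit.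
  have := (dvd_sub_pow_of_dvd_sub h k).trans (sub_dvd_pow_sub_pow _ _ m)
  rw [← pow_mul, ← pow_mul, pow_succ'] at this
  push_cast
  rw [← mul_assoc]
  exact hu.mul_right_dvd.2 this

/-- Substituting congruent integral series into a series in `P` gives congruent results. -/
lemma subst_sub_subst_mem_pIntegral {f : PowerSeries ℚ_[p]} (hf : f ∈ P p) {A B : PowerSeries ℤ_[p]}
    (hA : A.constantCoeff = 0) (hB : B.constantCoeff = 0) (hAB : (p : PowerSeries ℤ_[p]) ∣ A - B) :
    PowerSeries.subst (A.map PadicInt.Coe.ringHom) f -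
      PowerSeries.subst (B.map PadicInt.Coe.ringHom) f ∈ pIntegral p := by
  have hA' : PowerSeries.HasSubst (A.map (PadicInt.Coe.ringHom (p := p))) :=
    .of_constantCoeff_zero' (by
      rw [← PowerSeries.coeff_zero_eq_constantCoeff_apply, PowerSeries.coeff_map,
        PowerSeries.coeff_zero_eq_constantCoeff_apply, hA, map_zero])
  have hB' : PowerSeries.HasSubst (B.map (PadicInt.Coe.ringHom (p := p))) :=
    .of_constantCoeff_zero' (by
      rw [← PowerSeries.coeff_zero_eq_constantCoeff_apply, PowerSeries.coeff_map,
        PowerSeries.coeff_zero_eq_constantCoeff_apply, hB, map_zero])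
  intro n
  rw [map_sub, PowerSeries.coeff_subst' hA', PowerSeries.coeff_subst' hB',
    ← finsum_sub_distrib (PowerSeries.coeff_subst_finite' hA' f n)
      (PowerSeries.coeff_subst_finite' hB' f n)]
  refine finsum_induction (fun x : ℚ_[p] => ∃ z : ℤ_[p], x = p * z) ⟨0, by simp⟩ ?_ fun d => ?_
  · rintro _ _ ⟨x, rfl⟩ ⟨y, rfl⟩
    exact ⟨x + y, by rw [PadicInt.coe_add, mul_add]⟩
  · obtain ⟨z, hz⟩ := hf.2 d
    obtain ⟨D, hD⟩ := natCast_mul_dvd_pow_sub_pow hAB d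
    -- Here `z = d * f_d` and `A ^ d - B ^ d = p d D`: the factor `d` clears the denominator of
    -- `f_d`.
    refine ⟨z * D.coeff n, ?_⟩
    rw [← smul_sub, ← map_sub, ← map_pow, ← map_pow, ← map_sub, hD, PowerSeries.coeff_map,
      ← Nat.cast_mul, ← nsmul_eq_mul, map_nsmul, map_nsmul, nsmul_eq_mul, PadicInt.coe_mul, ← hz,
      smul_eq_mul, Nat.cast_mul]
    change _ * (_ * ((D.coeff n : ℤ_[p]) : ℚ_[p])) = _
    ring

lemma hasSubst_one_add_X_pow_sub_one (n : ℕ) :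
    PowerSeries.HasSubst ((1 + PowerSeries.X) ^ n - 1 : PowerSeries ℚ_[p]) :=
  .of_constantCoeff_zero' (by simp)

lemma phi_phi (f : PowerSeries ℚ_[p]) :
    phi p (phi p f) =
      PowerSeries.subst ((1 + PowerSeries.X) ^ p ^ 2 - 1 : PowerSeries ℚ_[p]) f := by
  have h := hasSubst_one_add_X_pow_sub_one (p := p) p
  rw [phi, phi, PowerSeries.subst_comp_subst_apply h h]
  congr 1
  rw [← PowerSeries.coe_substAlgHom h, map_sub, map_pow, map_add, map_one,
    PowerSeries.coe_substAlgHom h, PowerSeries.subst_X h]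
  ring

lemma frob_frob (f : PowerSeries ℚ_[p]) :
    frob p (frob p f) = PowerSeries.subst (PowerSeries.X ^ p ^ 2 : PowerSeries ℚ_[p]) f := by
  have h : PowerSeries.HasSubst (PowerSeries.X ^ p : PowerSeries ℚ_[p]) :=
    .X_pow (Fact.out : p.Prime).ne_zero
  rw [frob, frob, PowerSeries.subst_comp_subst_apply h h]
  congr 1
  rw [← PowerSeries.coe_substAlgHom h, map_pow, PowerSeries.coe_substAlgHom h,
    PowerSeries.subst_X h, ← pow_mul, sq]

lemma phi_phi_sub_frob_frob_mem {f : PowerSeries ℚ_[p]} (hf : f ∈ P p) :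
    phi p (phi p f) - frob p (frob p f) ∈ pIntegral p := by
  have hp : p.Prime := Fact.out
  have key := subst_sub_subst_mem_pIntegral hf
    (A := (1 + PowerSeries.X) ^ p ^ 2 - 1) (B := PowerSeries.X ^ p ^ 2) (by simp)
    (by simp [hp.ne_zero]) (by
      obtain ⟨r, hr⟩ := exists_add_pow_prime_pow_eq hp (1 : PowerSeries ℤ_[p]) PowerSeries.X 2
      exact ⟨PowerSeries.X * r, by rw [hr]; ring⟩)
  rw [phi_phi, frob_frob]
  simpa using key

lemma evalOp_X_sq_add_C (b : ℤ_[p]) (Φ : PowerSeries ℚ_[p] → PowerSeries ℚ_[p])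
    (f : PowerSeries ℚ_[p]) :
    evalOp (Polynomial.X ^ 2 + Polynomial.C b) Φ f = Φ (Φ f) + (b : ℚ_[p]) • f := by
  rw [evalOp, Polynomial.sum_add_index _ _ _ (by simp) (by simp [add_smul]),
    Polynomial.X_pow_eq_monomial, Polynomial.sum_monomial_index _ _ (by simp),
    Polynomial.sum_C_index (by simp)]
  simp

/-! ### The Eichler integral -/

variable (p) in
lemma eichlerIntegral_mem_P (a : ℕ → ℤ) : eichlerIntegral p a ∈ P p := by
  refine ⟨by simp [eichlerIntegral], fun n => ?_⟩
  rcases eq_or_ne n 0 with rfl | hn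
  · exact ⟨0, by simp⟩
  · refine ⟨a n, ?_⟩
    have : (n : ℚ_[p]) ≠ 0 := Nat.cast_ne_zero.2 hn
    simp [eichlerIntegral, hn]
    field_simp

/-- If `a (p n) = - p a (n / p)`, the Eichler integral satisfies the Frobenius congruence. -/
lemma frob_frob_eichlerIntegral_mem (a : ℕ → ℤ)
    (h : ∀ n, (p : ℤ) * (if p ∣ n then a (n / p) else 0) + a (p * n) = 0) :
    frob p (frob p (eichlerIntegral p a)) + (p : ℚ_[p]) • eichlerIntegral p a ∈ pIntegral p := by
  have hp : p.Prime := Fact.out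
  have hp' : (p : ℚ_[p]) ≠ 0 := Nat.cast_ne_zero.2 hp.ne_zero
  intro n
  rw [frob_frob, map_add, PowerSeries.coeff_subst_X_pow (pow_ne_zero 2 hp.ne_zero)]
  by_cases hn : p ∣ n
  -- The Hecke relation at `m = n / p` makes this coefficient exactly zero.
  · refine ⟨0, ?_⟩
    obtain ⟨m, rfl⟩ := hn
    have hm := h m
    rcases eq_or_ne m 0 with rfl | hm0
    · simp [eichlerIntegral]
    have hm0' : (m : ℚ_[p]) ≠ 0 := Nat.cast_ne_zero.2 hm0
    simp only [sq, Nat.mul_dvd_mul_iff_left hp.pos]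
    split_ifs at hm ⊢ with hd
    · obtain ⟨l, rfl⟩ := hd
      have hl0 : l ≠ 0 := by rintro rfl; simp at hm0
      have hl0' : (l : ℚ_[p]) ≠ 0 := Nat.cast_ne_zero.2 hl0
      rw [Nat.mul_div_cancel_left _ hp.pos] at hm
      rw [← mul_assoc, Nat.mul_div_cancel_left _ (mul_pos hp.pos hp.pos)]
      have hm' : (a (p * p * l) : ℚ_[p]) = -(p * a l) := by
        rw [mul_assoc, eq_neg_iff_add_eq_zero, add_comm]
        exact_mod_cast hm
      simp [eichlerIntegral, hl0, hp.ne_zero, hm']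
      field_simp
      ring
    · have hm' : a (p * m) = 0 := by simpa using hm
      simp [eichlerIntegral, hm']
  · have hu : ‖(n : ℚ_[p])‖ = 1 :=
      Padic.norm_natCast_eq_one_iff.2 ((Nat.Prime.coprime_iff_not_dvd hp).2 hn)
    have hn0 : n ≠ 0 := by rintro rfl; simp at hn
    have hnorm : ‖(a n : ℚ_[p]) / n‖ ≤ 1 := by
      rw [norm_div, hu, div_one]
      exact Padic.norm_int_le_one _
    refine ⟨⟨_, hnorm⟩, ?_⟩
    -- As `p ∤ n`, the `F²` term contributes nothing.
    rw [if_neg fun h' => hn ((dvd_pow_self p two_ne_zero).trans h')]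
    simp [eichlerIntegral, hn0]

end CMHonda

theorem mainTheorem5 (N : ℕ) [NeZero N] (g : CMHonda.S N 2)
    (hg : CMHonda.IsNormalizedNewform g)
    (a : ℕ → ℤ) (ha : ∀ n : ℕ, CMHonda.fourierCoeff g n = (a n : ℂ))
    (K : Type*) [Field K] [NumberField K] (hK : CMHonda.IsImaginaryQuadratic K)
    (hCM : CMHonda.HasCM g K)
    (p : ℕ) [Fact p.Prime] (hpN : ¬ p ∣ N) (hp : CMHonda.IsInert p K) :
    CMHonda.IsOfHondaType (Polynomial.X ^ 2 + Polynomial.C (p : ℤ_[p]))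
        (CMHonda.eichlerIntegral p a) ∧
      CMHonda.phi p (CMHonda.phi p (CMHonda.eichlerIntegral p a)) +
        (p : ℚ_[p]) • CMHonda.eichlerIntegral p a ∈ CMHonda.pIntegral p ∧
      CMHonda.frob p (CMHonda.frob p (CMHonda.eichlerIntegral p a)) +
        (p : ℚ_[p]) • CMHonda.eichlerIntegral p a ∈ CMHonda.pIntegral p := by
  have hpp : p.Prime := Fact.out
  obtain ⟨c, hc⟩ := hg.eigenform p hpp
  have hrel := CMHonda.fourierCoeff_hecke g hpp hpN hc
  have hap := CMHonda.fourierCoeff_inert_eq_zero hK hCM hpp hp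
  have hc0 : c = 0 := by
    -- At `n = 1` the Hecke relation reads `a p = c`.
    have := hrel 1
    rw [if_neg (by simpa using hpp.ne_one), mul_one, hap, hg.normalized] at this
    simpa using this.symm
  have hrec (n : ℕ) : (p : ℤ) * (if p ∣ n then a (n / p) else 0) + a (p * n) = 0 := by
    have := hrel n
    rw [hc0, zero_mul, ha, ha, show (2 : ℤ) - 1 = 1 by norm_num, zpow_one] at this
    split_ifs at this ⊢ <;> exact_mod_cast this
  have hP := CMHonda.eichlerIntegral_mem_P p a
  have hF := CMHonda.frob_frob_eichlerIntegral_mem a hrec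
  have hφ : CMHonda.phi p (CMHonda.phi p (CMHonda.eichlerIntegral p a)) +
      (p : ℚ_[p]) • CMHonda.eichlerIntegral p a ∈ CMHonda.pIntegral p := by
    have := CMHonda.add_mem_pIntegral (CMHonda.phi_phi_sub_frob_frob_mem hP) hF
    rwa [← add_assoc, sub_add_cancel] at this
  have ha1 : a 1 = 1 := by
    have := hg.normalized
    rw [ha] at this
    exact_mod_cast this
  refine ⟨⟨hP, by simp [CMHonda.eichlerIntegral, ha1], ?_, ?_⟩, hφ, hF⟩
  · rw [CMHonda.evalOp_X_sq_add_C, PadicInt.coe_natCast]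
    exact hφ
  · rw [CMHonda.evalOp_X_sq_add_C, PadicInt.coe_natCast]
    exact hF
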